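/- For $0\le r<1$ let $$\mathcal K(r)=\frac{\pi}{2}\,F\!\left(\tfrac12,\tfrac12;1;r^2\right)=\frac{\pi}{2}\sum_{n=0}^{\infty}\left(\frac{(1/2)_n}{n!}\right)^{2}r^{2n}$$ be the complete elliptic integral of the first kind, where $(a)_0=1$ and $(a)_{n+1}=(a)_n(a+n)$. For $0<r<1$ let $$\mu(r)=\frac{\pi}{2}\,\frac{\mathcal K(\sqrt{1-r^2})}{\mathcal K(r)},$$ which is a decreasing bijection of $(0,1)$ onto $(0,\infty)$, and for $K>0$ let $\varphi_K:(0,1)\to(0,1)$ be given by $\varphi_K(r)=\mu^{-1}(\mu(r)/K)$. Let $p:(0,1)\to\mathbb R$, $p(x)=\log\frac{x}{1-x}$, and $q=p^{-1}:\mathbb R\to(0,1)$, $q(x)=\frac{e^x}{1+e^x}$. **Theorem (linearization).** Let $K>1$. The function $g:\mathbb R\to\mathbb R$, $g(x)=p(\varphi_K(q(x)))$, is differentiable, its derivative $g'$ is strictly increasing on $\mathbb R$, and $g'(\mathbb R)=(1/K,K)$. -/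

import Mathlib

open Set

noncomputable section

/-- The complete elliptic integral of the first kind with modulus `r`, for `0 ≤ r < 1`, as the
Gauss hypergeometric series `K(r) = (π / 2) F(1/2, 1/2; 1; r ^ 2)`. -/
def ellipticIntegralK (r : ℝ) : ℝ :=
  Real.pi / 2 * ordinaryHypergeometric (1 / 2 : ℝ) (1 / 2 : ℝ) (1 : ℝ) (r ^ 2)

/-- The function `μ(r) = (π / 2) K(r') / K(r)` with `r' = √(1 - r ^ 2)`, for `0 < r < 1`
(the modulus of the planar Grötzsch ring). It maps `(0, 1)` bijectively onto `(0, ∞)`. -/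
def grotzschMu (r : ℝ) : ℝ :=
  Real.pi / 2 * (ellipticIntegralK (Real.sqrt (1 - r ^ 2)) / ellipticIntegralK r)

/-- The distortion function `φ_K(r) = μ⁻¹(μ(r) / K)`, for `0 < r < 1` and `K > 0`, where `μ⁻¹` is
the inverse of `μ` as a function on the interval `(0, 1)`. Only `r` in `(0, 1)` is meaningful. -/
def distortionPhi (K r : ℝ) : ℝ :=
  Function.invFunOn grotzschMu (Ioo 0 1) (grotzschMu r / K)

/-- The function `p(x) = log (x / (1 - x))` from `(0, 1)` onto `ℝ`. -/
def linP (x : ℝ) : ℝ := Real.log (x / (1 - x))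

/-- The function `q(x) = e ^ x / (1 + e ^ x)` from `ℝ` onto `(0, 1)`. -/
def linQ (x : ℝ) : ℝ := Real.exp x / (1 + Real.exp x)

/-- `q` takes its values in `(0, 1)`. -/
theorem linQ_mem (x : ℝ) : linQ x ∈ Ioo (0 : ℝ) 1 := by
  have h := Real.exp_pos x
  refine ⟨by unfold linQ; positivity, ?_⟩
  unfold linQ
  rw [div_lt_one (by positivity)]
  linarith

/-- `p` is a left inverse of `q`. -/
theorem linP_linQ (x : ℝ) : linP (linQ x) = x := by
  have h := Real.exp_pos x
  have e : linQ x / (1 - linQ x) = Real.exp x := by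
    unfold linQ
    have h1 : (1 + Real.exp x) ≠ 0 := by positivity
    have h2 : 1 - Real.exp x / (1 + Real.exp x) = 1 / (1 + Real.exp x) := by
      field_simp
      ring
    rw [h2]
    field_simp
  rw [linP, e, Real.log_exp]

/-- `q` is a left inverse of `p` on `(0, 1)`. -/
theorem linQ_linP {y : ℝ} (hy : y ∈ Ioo (0 : ℝ) 1) : linQ (linP y) = y := by
  have h1 : 0 < 1 - y := by linarith [hy.2]
  have h0 : 0 < y := hy.1
  rw [linQ, linP, Real.exp_log (div_pos h0 h1)]
  have h2 : 1 + y / (1 - y) = 1 / (1 - y) := by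
    field_simp
    ring
  rw [h2]
  field_simp

/-- The linearization `g(x) = p(φ_K(q(x)))` of `φ_K`. -/
def linearizedPhi (K x : ℝ) : ℝ := linP (distortionPhi K (linQ x))

end

/-!
Write `F(x) = F(1/2, 1/2; 1; x)`, so that `K(r) = (π / 2) F(r ^ 2)`, and `P(x) = x (1 - x) F'(x)`.
The hypergeometric equation is `P' = F / 4`; since `F(1 - x)` solves the same equation, the
Wronskian `P(x) F(1 - x) + F(x) P(1 - x)` is a positive constant `C` on `(0, 1)`
(`exists_halfHyp_wronskian`).

With `r = q(t)`, let `ν(t) = log (F(r ^ 2) / F(1 - r ^ 2))`, which is `-log μ(r)` up to an additive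
constant. The Wronskian gives `ν' = 2 C / ((1 + r) F(r ^ 2) F(1 - r ^ 2)) > 0`. As `F` is unbounded
at `1`, `ν` is an increasing bijection of `ℝ`, and `g` is the translation by `log K` read in the
coordinate `ν`: `ν(g(t)) = ν(t) + log K` (`linearizedPhi_eq`). Hence `g' = ν' / (ν' ∘ g)`, and since
`F(r ^ 2) / F(1 - r ^ 2)` is multiplied by `K` under `g`, this becomes
`g' = exp (D ∘ g - D) / K` with `D = log ((1 + r) F(r ^ 2) ^ 2)` (`deriv_linearizedPhi`).

Monotonicity of `g'` thus says that `D` is a strictly convex function of `ν`, that is, that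
`D' / ν'`, a constant multiple of `F(1 - r ^ 2) (r (1 - r) F(r ^ 2) + 4 P(r ^ 2))`, is strictly
increasing (`strictMono_densitySlope`). This follows from the bound `4 (1 - x) F'(x) ≤ F(x)`, which
holds for each Taylor coefficient (`four_mul_halfHypFlux_le`).

At `-∞` both `D` and `D ∘ g` tend to `0`, so `g'` tends to `1 / K`. At `+∞` the same expression
with `F(1 - r ^ 2)` in place of `F(r ^ 2)` and `K` in place of `1 / K` shows that `g'` tends to `K`.
-/

noncomputable section

open Filter Topology

/-! ### Power series with bounded coefficients -/

theorem summable_mul_pow_of_abs_le_one {b : ℕ → ℝ} (hb : ∀ n, |b n| ≤ 1) {x : ℝ} (hx : |x| < 1) :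
    Summable fun n => b n * x ^ n := by
  refine Summable.of_norm_bounded (summable_geometric_of_lt_one (abs_nonneg x) hx) fun n => ?_
  rw [Real.norm_eq_abs, abs_mul, abs_pow]
  exact mul_le_of_le_one_left (by positivity) (hb n)

theorem summable_natCast_mul_pow_pred {r : ℝ} (hr : |r| < 1) :
    Summable fun n : ℕ => (n : ℝ) * r ^ (n - 1) := by
  rw [← summable_nat_add_iff 1]
  have h1 := summable_pow_mul_geometric_of_norm_lt_one 1 (r := r) (by simpa using hr)
  have h0 := summable_pow_mul_geometric_of_norm_lt_one 0 (r := r) (by simpa using hr)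
  refine (h1.add h0).congr fun n => ?_
  simp only [Nat.add_sub_cancel]
  push_cast
  ring

/-- Termwise differentiation of a power series with bounded coefficients inside the unit disc. -/
theorem hasDerivAt_tsum_mul_pow {b : ℕ → ℝ} (hb : ∀ n, |b n| ≤ 1) {x : ℝ} (hx : |x| < 1) :
    HasDerivAt (fun y : ℝ => ∑' n, b n * y ^ n) (∑' n, b n * (n * x ^ (n - 1))) x := by
  obtain ⟨r, hxr, hr⟩ := exists_between hx
  have hr0 : 0 < r := (abs_nonneg x).trans_lt hxr
  refine hasDerivAt_tsum_of_isPreconnected (u := fun n : ℕ => (n : ℝ) * r ^ (n - 1))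
    (t := Ioo (-r) r) (y₀ := 0)
    (g' := fun n y => b n * (n * y ^ (n - 1)))
    (summable_natCast_mul_pow_pred (by rwa [abs_of_pos hr0])) isOpen_Ioo isPreconnected_Ioo
    (fun n y _ => (hasDerivAt_pow n y).const_mul (b n)) (fun n y hy => ?_)
    ⟨by linarith, hr0⟩ (summable_mul_pow_of_abs_le_one hb (by simp)) (abs_lt.mp hxr)
  rw [Real.norm_eq_abs, abs_mul, abs_mul, abs_pow, Nat.abs_cast]
  have hy' : |y| ≤ r := (abs_lt.mpr hy).le
  calc |b n| * (n * |y| ^ (n - 1)) ≤ 1 * (n * |y| ^ (n - 1)) := by gcongr; exact hb n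
    _ ≤ n * r ^ (n - 1) := by rw [one_mul]; gcongr

/-! ### The hypergeometric function `F(1/2, 1/2; 1; x)` -/

/-- The function `F(x) = F(1/2, 1/2; 1; x)`, so that `K(r) = (π / 2) F(r ^ 2)`. -/
def halfHyp (x : ℝ) : ℝ := ordinaryHypergeometric (1 / 2 : ℝ) (1 / 2 : ℝ) (1 : ℝ) x

/-- The coefficient `((1/2)_n / n!) ^ 2` of `x ^ n` in `F(1/2, 1/2; 1; x)`. -/
def halfHypCoeff (n : ℕ) : ℝ := ordinaryHypergeometricCoefficient (1 / 2 : ℝ) (1 / 2) 1 n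

theorem halfHyp_eq_tsum (x : ℝ) : halfHyp x = ∑' n, halfHypCoeff n * x ^ n := by
  simp only [halfHyp, halfHypCoeff, ordinaryHypergeometric_eq_tsum, smul_eq_mul]

theorem halfHypCoeff_zero : halfHypCoeff 0 = 1 := by
  simp [halfHypCoeff, ordinaryHypergeometricCoefficient]

theorem halfHypCoeff_succ (n : ℕ) :
    halfHypCoeff (n + 1) = halfHypCoeff n * ((n + 1 / 2) / (n + 1)) ^ 2 := by
  simp only [halfHypCoeff, ordinaryHypergeometricCoefficient, ascPochhammer_succ_eval,
    ascPochhammer_eval_one, Nat.factorial_succ]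
  have h1 : (n.factorial : ℝ) ≠ 0 := by positivity
  have h2 : (n : ℝ) + 1 ≠ 0 := by positivity
  push_cast
  field_simp
  ring

theorem halfHypCoeff_pos (n : ℕ) : 0 < halfHypCoeff n := by
  induction n with
  | zero => simp [halfHypCoeff_zero]
  | succ n ih => rw [halfHypCoeff_succ]; positivity

theorem halfHypCoeff_le_one (n : ℕ) : halfHypCoeff n ≤ 1 := by
  induction n with
  | zero => simp [halfHypCoeff_zero]
  | succ n ih =>
    rw [halfHypCoeff_succ]
    refine mul_le_one₀ ih (by positivity) (pow_le_one₀ (by positivity) ?_)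
    rw [div_le_one (by positivity)]
    linarith

theorem abs_halfHypCoeff_le_one (n : ℕ) : |halfHypCoeff n| ≤ 1 := by
  rw [abs_of_pos (halfHypCoeff_pos n)]
  exact halfHypCoeff_le_one n

theorem one_div_le_halfHypCoeff_succ (n : ℕ) :
    1 / 4 * (1 / ((n : ℝ) + 1)) ≤ halfHypCoeff (n + 1) := by
  induction n with
  | zero => norm_num [halfHypCoeff_succ, halfHypCoeff_zero]
  | succ n ih =>
    rw [halfHypCoeff_succ]
    refine le_trans ?_ (mul_le_mul_of_nonneg_right ih (by positivity))
    push_cast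
    rw [← sub_nonneg]
    have : 1 / 4 * (1 / ((n : ℝ) + 1)) * (((n : ℝ) + 1 + 1 / 2) / (n + 1 + 1)) ^ 2
        - 1 / 4 * (1 / ((n : ℝ) + 1 + 1)) = 1 / (16 * (n + 1) * (n + 1 + 1) ^ 2) := by
      field_simp
      ring
    rw [this]
    positivity

theorem summable_halfHyp {x : ℝ} (hx : |x| < 1) : Summable fun n => halfHypCoeff n * x ^ n :=
  summable_mul_pow_of_abs_le_one abs_halfHypCoeff_le_one hx

theorem sum_le_halfHyp {x : ℝ} (h0 : 0 ≤ x) (h1 : x < 1) (N : ℕ) :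
    ∑ n ∈ Finset.range N, halfHypCoeff n * x ^ n ≤ halfHyp x := by
  rw [halfHyp_eq_tsum]
  exact (summable_halfHyp (by rwa [abs_of_nonneg h0])).sum_le_tsum _
    fun n _ => mul_nonneg (halfHypCoeff_pos n).le (pow_nonneg h0 n)

theorem halfHyp_pos {x : ℝ} (h0 : 0 ≤ x) (h1 : x < 1) : 0 < halfHyp x := by
  have h := sum_le_halfHyp h0 h1 1
  simp [halfHypCoeff_zero] at h
  linarith

theorem halfHyp_zero : halfHyp 0 = 1 := ordinaryHypergeometric_zero _ _ _

/-- The coefficients of `F(1/2, 1/2; 1; x)` are bounded below by those of a logarithm, so the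
function is unbounded at `1`. -/
theorem tendsto_halfHyp_nhdsLT_one : Tendsto halfHyp (𝓝[<] 1) atTop := by
  rw [tendsto_atTop]
  intro M
  have hsum : Tendsto (fun N => ∑ n ∈ Finset.range N, 1 / 4 * (1 / ((n : ℝ) + 1))) atTop atTop := by
    simp_rw [← Finset.mul_sum]
    exact Tendsto.const_mul_atTop (by norm_num) Real.tendsto_sum_range_one_div_nat_succ_atTop
  obtain ⟨N, hN⟩ := (hsum.eventually_gt_atTop M).exists
  have hN' : M < ∑ n ∈ Finset.range (N + 1), halfHypCoeff n * (1 : ℝ) ^ n := by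
    rw [Finset.sum_range_succ']
    simp only [one_pow, mul_one]
    have := Finset.sum_le_sum fun n (_ : n ∈ Finset.range N) => one_div_le_halfHypCoeff_succ n
    linarith [halfHypCoeff_pos 0]
  have hc : Continuous fun x : ℝ => ∑ n ∈ Finset.range (N + 1), halfHypCoeff n * x ^ n := by
    fun_prop
  have hev : ∀ᶠ x in 𝓝[<] (1 : ℝ), M < ∑ n ∈ Finset.range (N + 1), halfHypCoeff n * x ^ n :=
    ((hc.tendsto 1).mono_left nhdsWithin_le_nhds).eventually (lt_mem_nhds hN')
  filter_upwards [hev, Ioo_mem_nhdsLT (show (0 : ℝ) < 1 by norm_num)] with x hx hx1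
  exact hx.le.trans (sum_le_halfHyp hx1.1.le hx1.2 _)

/-- The function `P(x) = x (1 - x) F'(x)` for `F(x) = F(1/2, 1/2; 1; x)`, encoded by its power
series. The coefficient of `x ^ 0` is `0`, because `c / 0 = 0`. -/
def halfHypFlux (x : ℝ) : ℝ := ∑' n : ℕ, halfHypCoeff (n - 1) / (4 * n) * x ^ n

theorem abs_halfHypFluxCoeff_le_one (n : ℕ) : |halfHypCoeff (n - 1) / (4 * n)| ≤ 1 := by
  rcases n with _ | n
  · simp
  · rw [abs_of_nonneg (div_nonneg (halfHypCoeff_pos _).le (by positivity))]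
    rw [div_le_one (by positivity)]
    have : halfHypCoeff n ≤ 1 := halfHypCoeff_le_one n
    simp only [Nat.add_sub_cancel]
    push_cast
    have : (0 : ℝ) ≤ n := by positivity
    linarith

theorem summable_halfHypFlux {x : ℝ} (hx : |x| < 1) :
    Summable fun n : ℕ => halfHypCoeff n / (4 * (n + 1)) * x ^ (n + 1) := by
  have h := (summable_nat_add_iff (f := fun n : ℕ => halfHypCoeff (n - 1) / (4 * n) * x ^ n) 1).mpr
    (summable_mul_pow_of_abs_le_one abs_halfHypFluxCoeff_le_one hx)
  exact_mod_cast h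

theorem halfHypFlux_eq_tsum {x : ℝ} (hx : |x| < 1) :
    halfHypFlux x = ∑' n : ℕ, halfHypCoeff n / (4 * (n + 1)) * x ^ (n + 1) := by
  have h := summable_mul_pow_of_abs_le_one abs_halfHypFluxCoeff_le_one hx
  rw [halfHypFlux, h.tsum_eq_zero_add]
  simp

/-- The hypergeometric equation `(x (1 - x) F'(x))' = F(x) / 4`. -/
theorem hasDerivAt_halfHypFlux {x : ℝ} (hx : |x| < 1) :
    HasDerivAt halfHypFlux (halfHyp x / 4) x := by
  have h := hasDerivAt_tsum_mul_pow abs_halfHypFluxCoeff_le_one hx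
  convert! h using 1
  rw [tsum_eq_zero_add' (f := fun n : ℕ => halfHypCoeff (n - 1) / (4 * n) * (n * x ^ (n - 1)))]
  · simp only [Nat.cast_zero, zero_mul, mul_zero, zero_add, Nat.add_sub_cancel]
    rw [halfHyp_eq_tsum, ← tsum_div_const]
    refine tsum_congr fun n => ?_
    push_cast
    field_simp
  · refine ((summable_halfHyp hx).div_const 4).congr fun n => ?_
    simp only [Nat.add_sub_cancel]
    push_cast
    field_simp

theorem hasDerivAt_halfHyp {x : ℝ} (h0 : 0 < x) (h1 : x < 1) :
    HasDerivAt halfHyp (halfHypFlux x / (x * (1 - x))) x := by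
  have hx : |x| < 1 := by rwa [abs_of_pos h0]
  have h := hasDerivAt_tsum_mul_pow abs_halfHypCoeff_le_one hx
  have hF : halfHyp = fun y => ∑' n, halfHypCoeff n * y ^ n := funext halfHyp_eq_tsum
  rw [hF]
  convert! h using 1
  have hx1 : 1 - x ≠ 0 := by linarith
  rw [div_eq_iff (mul_ne_zero h0.ne' hx1)]
  have hs : Summable fun n : ℕ => halfHypCoeff n * (n * x ^ (n - 1)) := by
    refine Summable.of_norm_bounded (summable_natCast_mul_pow_pred hx).abs fun n => ?_
    rw [Real.norm_eq_abs, abs_mul]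
    exact mul_le_of_le_one_left (abs_nonneg _) (abs_halfHypCoeff_le_one n)
  have hs0 : Summable fun n : ℕ => n * halfHypCoeff n * x ^ n := by
    refine (hs.mul_right x).congr fun n => ?_
    rcases n with _ | n
    · simp
    · simp only [Nat.add_sub_cancel]; ring
  have hsx : ∑' n : ℕ, halfHypCoeff n * (n * x ^ (n - 1)) * x
      = ∑' n : ℕ, n * halfHypCoeff n * x ^ n := by
    refine tsum_congr fun n => ?_
    rcases n with _ | n
    · simp
    · simp only [Nat.add_sub_cancel]; ring
  have hs1 : Summable fun n : ℕ => (↑(n + 1) : ℝ) * halfHypCoeff (n + 1) * x ^ (n + 1) :=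
    (summable_nat_add_iff (f := fun n : ℕ => n * halfHypCoeff n * x ^ n) 1).mpr hs0
  have hshift : ∑' n : ℕ, n * halfHypCoeff n * x ^ n
      = ∑' n : ℕ, (↑(n + 1) : ℝ) * halfHypCoeff (n + 1) * x ^ (n + 1) := by
    rw [tsum_eq_zero_add' (f := fun n : ℕ => n * halfHypCoeff n * x ^ n) hs1]
    simp
  calc halfHypFlux x
      = ∑' n : ℕ, ((↑(n + 1) : ℝ) * halfHypCoeff (n + 1) * x ^ (n + 1)
          - n * halfHypCoeff n * x ^ n * x) := by
        rw [halfHypFlux_eq_tsum hx]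
        refine tsum_congr fun n => ?_
        rw [halfHypCoeff_succ]
        push_cast
        field_simp
        ring
    _ = (∑' n : ℕ, n * halfHypCoeff n * x ^ n) * (1 - x) := by
        rw [hs1.tsum_sub (hs0.mul_right x), ← hshift, tsum_mul_right]
        ring
    _ = (∑' n : ℕ, halfHypCoeff n * (n * x ^ (n - 1))) * (x * (1 - x)) := by
        rw [← hsx, tsum_mul_right]
        ring

theorem continuousAt_halfHyp {x : ℝ} (hx : |x| < 1) : ContinuousAt halfHyp x := by
  have hF : halfHyp = fun y => ∑' n, halfHypCoeff n * y ^ n := funext halfHyp_eq_tsum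
  rw [hF]
  exact (hasDerivAt_tsum_mul_pow abs_halfHypCoeff_le_one hx).continuousAt

theorem halfHypFlux_pos {x : ℝ} (h0 : 0 < x) (h1 : x < 1) : 0 < halfHypFlux x := by
  have hx : |x| < 1 := by rwa [abs_of_pos h0]
  refine (summable_mul_pow_of_abs_le_one abs_halfHypFluxCoeff_le_one hx).tsum_pos
    (fun n => ?_) 1 ?_
  · exact mul_nonneg (div_nonneg (halfHypCoeff_pos _).le (by positivity)) (by positivity)
  · have := halfHypCoeff_pos (1 - 1)
    positivity

/-- The bound `4 (1 - x) F'(x) ≤ F(x)`, which holds coefficient by coefficient. -/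
theorem four_mul_halfHypFlux_le {x : ℝ} (h0 : 0 < x) (h1 : x < 1) :
    4 * halfHypFlux x ≤ x * halfHyp x := by
  have hx : |x| < 1 := by rwa [abs_of_pos h0]
  rw [halfHyp_eq_tsum, halfHypFlux_eq_tsum hx, ← tsum_mul_left, ← tsum_mul_left]
  refine Summable.tsum_le_tsum (fun n => ?_) ((summable_halfHypFlux hx).mul_left 4)
    ((summable_halfHyp hx).mul_left x)
  have hc := halfHypCoeff_pos n
  have hn : (1 : ℝ) ≤ (n : ℝ) + 1 := by linarith [(Nat.cast_nonneg n : (0 : ℝ) ≤ n)]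
  calc 4 * (halfHypCoeff n / (4 * ((n : ℝ) + 1)) * x ^ (n + 1))
      = halfHypCoeff n * x ^ (n + 1) / ((n : ℝ) + 1) := by field_simp
    _ ≤ halfHypCoeff n * x ^ (n + 1) := div_le_self (by positivity) hn
    _ = x * (halfHypCoeff n * x ^ n) := by ring

/-- The Wronskian of the solutions `F(x)` and `F(1 - x)` of the hypergeometric equation, multiplied
by `x (1 - x)`, is constant on `(0, 1)`. -/
theorem exists_halfHyp_wronskian : ∃ C : ℝ, 0 < C ∧ ∀ x ∈ Ioo (0 : ℝ) 1,
    halfHypFlux x * halfHyp (1 - x) + halfHyp x * halfHypFlux (1 - x) = C := by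
  set w : ℝ → ℝ := fun x => halfHypFlux x * halfHyp (1 - x) + halfHyp x * halfHypFlux (1 - x)
  have hw : ∀ x ∈ Ioo (0 : ℝ) 1, HasDerivAt w 0 x := by
    rintro x ⟨h0, h1⟩
    have hx : |x| < 1 := by rwa [abs_of_pos h0]
    have hx' : |1 - x| < 1 := by rw [abs_of_pos (by linarith)]; linarith
    have hs : HasDerivAt (fun y : ℝ => 1 - y) (-1) x := by
      simpa using (hasDerivAt_id x).const_sub 1
    have hP := hasDerivAt_halfHypFlux hx
    have hF := hasDerivAt_halfHyp h0 h1
    have hP' := (hasDerivAt_halfHypFlux hx').comp x hs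
    have hF' := (hasDerivAt_halfHyp (x := 1 - x) (by linarith) (by linarith)).comp x hs
    refine ((hP.mul hF').add (hF.mul hP')).congr_deriv ?_
    have : 1 - x ≠ 0 := by linarith
    simp only [Function.comp, sub_sub_cancel]
    field_simp
    ring
  have hhalf : (1 / 2 : ℝ) ∈ Ioo (0 : ℝ) 1 := by norm_num
  refine ⟨w (1 / 2), ?_, fun x hx => ?_⟩
  · have h1 := halfHypFlux_pos (x := 1 / 2) (by norm_num) (by norm_num)
    have h2 := halfHyp_pos (x := 1 / 2) (by norm_num) (by norm_num)
    have h3 : (1 : ℝ) - 1 / 2 = 1 / 2 := by norm_num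
    simp only [w, h3]
    positivity
  · exact isOpen_Ioo.is_const_of_deriv_eq_zero isPreconnected_Ioo
      (fun y hy => (hw y hy).differentiableAt.differentiableWithinAt)
      (fun y hy => (hw y hy).deriv) hx hhalf

/-! ### The functions `F(r ^ 2)` and `F(1 - r ^ 2)` in the logistic coordinate -/

theorem hasDerivAt_linQ (t : ℝ) : HasDerivAt linQ (linQ t * (1 - linQ t)) t := by
  have he := Real.exp_pos t
  have h1 : 1 + Real.exp t ≠ 0 := by positivity
  refine ((Real.hasDerivAt_exp t).div ((Real.hasDerivAt_exp t).const_add 1) h1).congr_deriv ?_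
  unfold linQ
  field_simp

theorem tendsto_linQ_atBot : Tendsto linQ atBot (𝓝[>] 0) := by
  refine tendsto_nhdsWithin_iff.mpr ⟨?_, Eventually.of_forall fun t => (linQ_mem t).1⟩
  have h := Real.tendsto_exp_atBot.div (Real.tendsto_exp_atBot.const_add 1) (by norm_num)
  rwa [zero_div] at h

theorem one_sub_linQ (t : ℝ) : 1 - linQ t = linQ (-t) := by
  have he := Real.exp_pos t
  simp only [linQ, Real.exp_neg]
  field_simp
  ring

theorem tendsto_linQ_atTop : Tendsto linQ atTop (𝓝[<] 1) := by
  refine tendsto_nhdsWithin_iff.mpr ⟨?_, Eventually.of_forall fun t => (linQ_mem t).2⟩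
  have h : Tendsto (fun t => 1 - linQ (-t)) atTop (𝓝 (1 - 0)) :=
    ((tendsto_nhdsWithin_iff.mp tendsto_linQ_atBot).1.comp tendsto_neg_atTop_atBot).const_sub 1
  rw [sub_zero] at h
  refine h.congr fun t => ?_
  rw [← one_sub_linQ, sub_sub_cancel]

theorem linQ_sq_mem (t : ℝ) : linQ t ^ 2 ∈ Ioo (0 : ℝ) 1 := by
  obtain ⟨h0, h1⟩ := linQ_mem t
  exact ⟨by positivity, by nlinarith⟩

theorem one_sub_linQ_sq_mem (t : ℝ) : 1 - linQ t ^ 2 ∈ Ioo (0 : ℝ) 1 := by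
  obtain ⟨h0, h1⟩ := linQ_sq_mem t
  exact ⟨by linarith, by linarith⟩

theorem hasDerivAt_linQ_sq (t : ℝ) :
    HasDerivAt (fun t => linQ t ^ 2) (2 * linQ t ^ 2 * (1 - linQ t)) t := by
  refine ((hasDerivAt_linQ t).pow 2).congr_deriv ?_
  simp
  ring

/-- The function `F(r ^ 2) = (2 / π) K(r)` at `r = q(t)`. -/
def hypQ (t : ℝ) : ℝ := halfHyp (linQ t ^ 2)

/-- The function `F(1 - r ^ 2) = (2 / π) K(r')` at `r = q(t)`. -/
def hypQCompl (t : ℝ) : ℝ := halfHyp (1 - linQ t ^ 2)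

/-- The function `P(r ^ 2)` at `r = q(t)`. -/
def fluxQ (t : ℝ) : ℝ := halfHypFlux (linQ t ^ 2)

/-- The function `P(1 - r ^ 2)` at `r = q(t)`. -/
def fluxQCompl (t : ℝ) : ℝ := halfHypFlux (1 - linQ t ^ 2)

theorem hypQ_pos (t : ℝ) : 0 < hypQ t := halfHyp_pos (linQ_sq_mem t).1.le (linQ_sq_mem t).2

theorem hypQCompl_pos (t : ℝ) : 0 < hypQCompl t :=
  halfHyp_pos (one_sub_linQ_sq_mem t).1.le (one_sub_linQ_sq_mem t).2

theorem hasDerivAt_hypQ (t : ℝ) : HasDerivAt hypQ (2 * fluxQ t / (1 + linQ t)) t := by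
  obtain ⟨h0, h1⟩ := linQ_mem t
  refine ((hasDerivAt_halfHyp (linQ_sq_mem t).1 (linQ_sq_mem t).2).comp t
    (hasDerivAt_linQ_sq t)).congr_deriv ?_
  have h3 : 1 - linQ t ≠ 0 := by linarith
  have h4 : 1 + linQ t ≠ 0 := by positivity
  have h5 : 1 - linQ t ^ 2 = (1 - linQ t) * (1 + linQ t) := by ring
  rw [h5, fluxQ]
  field_simp

theorem hasDerivAt_hypQCompl (t : ℝ) :
    HasDerivAt hypQCompl (-(2 * fluxQCompl t / (1 + linQ t))) t := by
  obtain ⟨h0, h1⟩ := linQ_mem t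
  refine ((hasDerivAt_halfHyp (one_sub_linQ_sq_mem t).1 (one_sub_linQ_sq_mem t).2).comp t
    ((hasDerivAt_linQ_sq t).const_sub 1)).congr_deriv ?_
  have h3 : 1 - linQ t ≠ 0 := by linarith
  have h4 : 1 + linQ t ≠ 0 := by positivity
  have h5 : (1 - linQ t ^ 2) * (1 - (1 - linQ t ^ 2))
      = (1 - linQ t) * (1 + linQ t) * linQ t ^ 2 := by ring
  rw [h5, fluxQCompl]
  field_simp

theorem hasDerivAt_fluxQ (t : ℝ) :
    HasDerivAt fluxQ (hypQ t * linQ t ^ 2 * (1 - linQ t) / 2) t := by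
  have h : |linQ t ^ 2| < 1 := by rw [abs_of_pos (linQ_sq_mem t).1]; exact (linQ_sq_mem t).2
  refine ((hasDerivAt_halfHypFlux h).comp t (hasDerivAt_linQ_sq t)).congr_deriv ?_
  rw [hypQ]
  ring

theorem tendsto_hypQ_atBot : Tendsto hypQ atBot (𝓝 1) := by
  have h := (tendsto_nhdsWithin_iff.mp tendsto_linQ_atBot).1.pow 2
  have hc := (continuousAt_halfHyp (x := 0) (by simp)).tendsto
  rw [halfHyp_zero] at hc
  exact hc.comp (by simpa using h)

theorem tendsto_hypQCompl_atTop : Tendsto hypQCompl atTop (𝓝 1) := by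
  have h := ((tendsto_nhdsWithin_iff.mp tendsto_linQ_atTop).1.pow 2).const_sub 1
  have hc := (continuousAt_halfHyp (x := 0) (by simp)).tendsto
  rw [halfHyp_zero] at hc
  exact hc.comp (by simpa using h)

theorem tendsto_hypQ_atTop : Tendsto hypQ atTop atTop := by
  refine tendsto_halfHyp_nhdsLT_one.comp (tendsto_nhdsWithin_iff.mpr
    ⟨?_, Eventually.of_forall fun t => (linQ_sq_mem t).2⟩)
  simpa using (tendsto_nhdsWithin_iff.mp tendsto_linQ_atTop).1.pow 2

theorem tendsto_hypQCompl_atBot : Tendsto hypQCompl atBot atTop := by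
  refine tendsto_halfHyp_nhdsLT_one.comp (tendsto_nhdsWithin_iff.mpr
    ⟨?_, Eventually.of_forall fun t => (one_sub_linQ_sq_mem t).2⟩)
  simpa using ((tendsto_nhdsWithin_iff.mp tendsto_linQ_atBot).1.pow 2).const_sub 1

/-! ### The coordinate that turns `φ_K` into a translation -/

/-- The function `ν(t) = log (F(r ^ 2) / F(1 - r ^ 2))` at `r = q(t)`, so that
`μ(q(t)) = (π / 2) e ^ (-ν(t))`. -/
def logModulus (t : ℝ) : ℝ := Real.log (hypQ t) - Real.log (hypQCompl t)

/-- By the Wronskian identity, `ν' = 2 C / ((1 + r) F(r ^ 2) F(1 - r ^ 2))` for a constant `C > 0`.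
Its value (`1 / π`, by Legendre's relation) plays no role. -/
theorem exists_hasDerivAt_logModulus : ∃ C : ℝ, 0 < C ∧ ∀ t,
    HasDerivAt logModulus (2 * C / ((1 + linQ t) * hypQ t * hypQCompl t)) t := by
  obtain ⟨C, hC, hw⟩ := exists_halfHyp_wronskian
  refine ⟨C, hC, fun t => ?_⟩
  have h1 := (hypQ_pos t).ne'
  have h2 := (hypQCompl_pos t).ne'
  have h3 : 1 + linQ t ≠ 0 := by linarith [(linQ_mem t).1]
  have hw' : fluxQ t * hypQCompl t + hypQ t * fluxQCompl t = C := hw _ (linQ_sq_mem t)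
  refine (((hasDerivAt_hypQ t).log h1).sub ((hasDerivAt_hypQCompl t).log h2)).congr_deriv ?_
  rw [← hw']
  field_simp
  ring

theorem differentiable_logModulus : Differentiable ℝ logModulus := by
  obtain ⟨C, -, h⟩ := exists_hasDerivAt_logModulus
  exact fun t => (h t).differentiableAt

theorem strictMono_logModulus : StrictMono logModulus := by
  obtain ⟨C, hC, h⟩ := exists_hasDerivAt_logModulus
  refine strictMono_of_deriv_pos fun t => ?_
  rw [(h t).deriv]
  have := hypQ_pos t
  have := hypQCompl_pos t
  have := (linQ_mem t).1
  positivity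

theorem surjective_logModulus : Function.Surjective logModulus := by
  refine differentiable_logModulus.continuous.surjective ?_ ?_
  · have h2 := (tendsto_hypQCompl_atTop.log one_ne_zero).neg
    exact (Real.tendsto_log_atTop.comp tendsto_hypQ_atTop).atTop_add h2
  · have h1 := tendsto_hypQ_atBot.log one_ne_zero
    exact h1.add_atBot (tendsto_neg_atTop_atBot.comp
      (Real.tendsto_log_atTop.comp tendsto_hypQCompl_atBot))

/-- The function `ν` as an order isomorphism of `ℝ`. -/
def logModulusIso : ℝ ≃o ℝ := strictMono_logModulus.orderIsoOfSurjective _ surjective_logModulus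

theorem logModulusIso_apply (t : ℝ) : logModulusIso t = logModulus t := rfl

theorem grotzschMu_linQ (t : ℝ) : grotzschMu (linQ t) = Real.pi / 2 * Real.exp (-logModulus t) := by
  have h1 := hypQ_pos t
  have h2 := hypQCompl_pos t
  rw [logModulus, neg_sub, Real.exp_sub, Real.exp_log h1, Real.exp_log h2, grotzschMu,
    ellipticIntegralK, ellipticIntegralK, Real.sq_sqrt (one_sub_linQ_sq_mem t).1.le]
  change Real.pi / 2 * ((Real.pi / 2 * hypQCompl t) / (Real.pi / 2 * hypQ t)) = _
  rw [mul_div_mul_left _ _ (by positivity)]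

theorem grotzschMu_linQ_eq_div_iff {K : ℝ} (hK : 0 < K) (s t : ℝ) :
    grotzschMu (linQ s) = grotzschMu (linQ t) / K ↔ logModulus s = logModulus t + Real.log K := by
  have hpi : (Real.pi / 2 : ℝ) ≠ 0 := by positivity
  rw [grotzschMu_linQ, grotzschMu_linQ, mul_div_assoc, mul_right_inj' hpi]
  nth_rw 1 [← Real.exp_log hK]
  rw [← Real.exp_sub, Real.exp_eq_exp]
  constructor <;> intro h <;> linarith

/-- In the coordinate `ν` the linearization of `φ_K` is the translation by `log K`. -/
theorem linearizedPhi_eq {K : ℝ} (hK : 0 < K) (t : ℝ) :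
    linearizedPhi K t = logModulusIso.symm (logModulusIso t + Real.log K) := by
  set s₀ := logModulusIso.symm (logModulusIso t + Real.log K) with hs₀
  have hs₀' : logModulus s₀ = logModulus t + Real.log K := by
    rw [← logModulusIso_apply, hs₀, OrderIso.apply_symm_apply, logModulusIso_apply]
  have hex : ∃ r ∈ Ioo (0 : ℝ) 1, grotzschMu r = grotzschMu (linQ t) / K :=
    ⟨linQ s₀, linQ_mem s₀, (grotzschMu_linQ_eq_div_iff hK s₀ t).mpr hs₀'⟩
  have hmem := Function.invFunOn_mem hex
  have heq := Function.invFunOn_eq hex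
  change distortionPhi K (linQ t) ∈ Ioo (0 : ℝ) 1 at hmem
  change grotzschMu (distortionPhi K (linQ t)) = _ at heq
  rw [← linQ_linP hmem, grotzschMu_linQ_eq_div_iff hK, ← hs₀'] at heq
  exact strictMono_logModulus.injective heq

theorem logModulus_linearizedPhi {K : ℝ} (hK : 0 < K) (t : ℝ) :
    logModulus (linearizedPhi K t) = logModulus t + Real.log K := by
  rw [linearizedPhi_eq hK, ← logModulusIso_apply, OrderIso.apply_symm_apply, logModulusIso_apply]

theorem lt_linearizedPhi {K : ℝ} (hK : 1 < K) (t : ℝ) : t < linearizedPhi K t := by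
  rw [← strictMono_logModulus.lt_iff_lt, logModulus_linearizedPhi (by linarith)]
  linarith [Real.log_pos hK]

theorem tendsto_linearizedPhi_atBot {K : ℝ} (hK : 0 < K) :
    Tendsto (linearizedPhi K) atBot atBot := by
  rw [show linearizedPhi K = fun t => _ from funext (linearizedPhi_eq hK)]
  exact logModulusIso.symm.tendsto_atBot.comp
    (tendsto_atBot_add_const_right _ _ logModulusIso.tendsto_atBot)

theorem tendsto_linearizedPhi_atTop {K : ℝ} (hK : 0 < K) :
    Tendsto (linearizedPhi K) atTop atTop := by
  rw [show linearizedPhi K = fun t => _ from funext (linearizedPhi_eq hK)]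
  exact logModulusIso.symm.tendsto_atTop.comp
    (tendsto_atTop_add_const_right _ _ logModulusIso.tendsto_atTop)

/-! ### The derivative of the linearization -/

theorem hasDerivAt_linearizedPhi {K : ℝ} (hK : 0 < K) (t : ℝ) :
    HasDerivAt (linearizedPhi K)
      ((1 + linQ (linearizedPhi K t)) * hypQ (linearizedPhi K t) * hypQCompl (linearizedPhi K t)
        / ((1 + linQ t) * hypQ t * hypQCompl t)) t := by
  obtain ⟨C, hC, h⟩ := exists_hasDerivAt_logModulus
  have p1 := hypQ_pos (linearizedPhi K t)
  have p2 := hypQCompl_pos (linearizedPhi K t)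
  have p3 := (linQ_mem (linearizedPhi K t)).1
  have hne : 2 * C / ((1 + linQ (linearizedPhi K t)) * hypQ (linearizedPhi K t) *
      hypQCompl (linearizedPhi K t)) ≠ 0 := by positivity
  have hinv : HasDerivAt logModulusIso.symm _ (logModulus t + Real.log K) :=
    HasDerivAt.of_local_left_inverse (f := logModulus)
      logModulusIso.symm.continuous.continuousAt
      (by have := h (linearizedPhi K t)
          rwa [linearizedPhi_eq hK] at this) (by rwa [linearizedPhi_eq hK] at hne)
      (Eventually.of_forall logModulusIso.apply_symm_apply)
  rw [← logModulusIso_apply, ← linearizedPhi_eq hK] at hinv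
  have hcomp := hinv.comp t ((h t).add_const (Real.log K))
  refine (hcomp.congr_of_eventuallyEq (Eventually.of_forall (linearizedPhi_eq hK))).congr_deriv ?_
  have q1 := hypQ_pos t
  have q2 := hypQCompl_pos t
  have q3 := (linQ_mem t).1
  field_simp

theorem hypQ_linearizedPhi_mul_hypQCompl {K : ℝ} (hK : 0 < K) (t : ℝ) :
    hypQ (linearizedPhi K t) * hypQCompl t = K * (hypQ t * hypQCompl (linearizedPhi K t)) := by
  have p1 := hypQ_pos (linearizedPhi K t)
  have p2 := hypQCompl_pos (linearizedPhi K t)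
  have q1 := hypQ_pos t
  have q2 := hypQCompl_pos t
  have h := logModulus_linearizedPhi hK t
  unfold logModulus at h
  apply Real.log_injOn_pos (mem_Ioi.mpr (by positivity)) (mem_Ioi.mpr (by positivity))
  rw [Real.log_mul p1.ne' q2.ne', Real.log_mul hK.ne' (by positivity),
    Real.log_mul q1.ne' p2.ne']
  linarith

/-- The function `D(t) = log ((1 + r) F(r ^ 2) ^ 2)` at `r = q(t)`. -/
def logDensity (t : ℝ) : ℝ := Real.log (1 + linQ t) + 2 * Real.log (hypQ t)

theorem exp_logDensity (t : ℝ) : Real.exp (logDensity t) = (1 + linQ t) * hypQ t ^ 2 := by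
  have h := hypQ_pos t
  rw [logDensity, Real.exp_add, Real.exp_log (by linarith [(linQ_mem t).1]), two_mul, Real.exp_add,
    Real.exp_log h]
  ring

/-- The derivative in terms of `F(r ^ 2)`, which stays bounded as `r → 0`. -/
theorem deriv_linearizedPhi {K : ℝ} (hK : 0 < K) (t : ℝ) :
    deriv (linearizedPhi K) t
      = 1 / K * Real.exp (logDensity (linearizedPhi K t) - logDensity t) := by
  have p3 := (linQ_mem t).1
  have q1 := hypQ_pos t
  have q2 := hypQCompl_pos t
  rw [(hasDerivAt_linearizedPhi hK t).deriv, Real.exp_sub, exp_logDensity, exp_logDensity,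
    div_mul_div_comm, div_eq_div_iff (by positivity) (by positivity)]
  linear_combination (-((1 + linQ (linearizedPhi K t)) * hypQ (linearizedPhi K t)
    * (1 + linQ t) * hypQ t)) * hypQ_linearizedPhi_mul_hypQCompl hK t

/-- The derivative in terms of `F(1 - r ^ 2)`, which, unlike `F(r ^ 2)`, stays bounded as
`r → 1`. -/
theorem deriv_linearizedPhi' {K : ℝ} (hK : 0 < K) (t : ℝ) :
    deriv (linearizedPhi K) t
      = K * ((1 + linQ (linearizedPhi K t)) * hypQCompl (linearizedPhi K t) ^ 2
        / ((1 + linQ t) * hypQCompl t ^ 2)) := by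
  have p3 := (linQ_mem t).1
  have q1 := hypQ_pos t
  have q2 := hypQCompl_pos t
  rw [(hasDerivAt_linearizedPhi hK t).deriv, mul_div_assoc',
    div_eq_div_iff (by positivity) (by positivity)]
  linear_combination ((1 + linQ (linearizedPhi K t)) * hypQCompl (linearizedPhi K t)
    * (1 + linQ t) * hypQCompl t) * hypQ_linearizedPhi_mul_hypQCompl hK t

/-- The function `F(1 - r ^ 2) (r (1 - r) F(r ^ 2) + 4 P(r ^ 2))` at `r = q(t)`, a constant multiple
of `D' / ν'`. -/
def densitySlope (t : ℝ) : ℝ :=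
  (linQ t * (1 - linQ t) * hypQ t + 4 * fluxQ t) * hypQCompl t

theorem hasDerivAt_logDensity (t : ℝ) :
    HasDerivAt logDensity (densitySlope t / ((1 + linQ t) * hypQ t * hypQCompl t)) t := by
  have p3 : 0 < 1 + linQ t := by linarith [(linQ_mem t).1]
  have q1 := hypQ_pos t
  have q2 := hypQCompl_pos t
  refine ((((hasDerivAt_linQ t).const_add 1).log p3.ne').add
    (((hasDerivAt_hypQ t).log q1.ne').const_mul 2)).congr_deriv ?_
  unfold densitySlope
  field_simp
  ring

/-- `D' / ν'` is strictly increasing, that is, `D` is a strictly convex function of `ν`. In the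
derivative the only negative term carries `P(1 - r ^ 2)`, and the bound `4 P(x) ≤ x F(x)` at
`x = 1 - r ^ 2` and at `x = r ^ 2` shows that it is outweighed. -/
theorem strictMono_densitySlope : StrictMono densitySlope := by
  refine strictMono_of_deriv_pos fun t => ?_
  obtain ⟨h0, h1⟩ := linQ_mem t
  have hd := ((((hasDerivAt_linQ t).mul ((hasDerivAt_linQ t).const_sub 1)).mul
    (hasDerivAt_hypQ t)).add ((hasDerivAt_fluxQ t).const_mul 4)).mul (hasDerivAt_hypQCompl t)
  have hd' : HasDerivAt densitySlope _ t := hd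
  rw [hd'.deriv]
  simp only [Pi.mul_apply, Pi.add_apply]
  have hF := hypQ_pos t
  have hL := hypQCompl_pos t
  have hb : 4 * fluxQ t ≤ linQ t ^ 2 * hypQ t :=
    four_mul_halfHypFlux_le (linQ_sq_mem t).1 (linQ_sq_mem t).2
  have hb' : 4 * fluxQCompl t ≤ (1 - linQ t ^ 2) * hypQCompl t :=
    four_mul_halfHypFlux_le (one_sub_linQ_sq_mem t).1 (one_sub_linQ_sq_mem t).2
  have hP : 0 < fluxQ t := halfHypFlux_pos (linQ_sq_mem t).1 (linQ_sq_mem t).2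
  generalize linQ t = r at *
  generalize hypQ t = F at *
  generalize hypQCompl t = L at *
  generalize fluxQ t = P at *
  generalize fluxQCompl t = P' at *
  have h1r : 0 < 1 + r := by linarith
  have h1r' : 0 < 1 - r := by linarith
  -- Replace `P(1 - r ^ 2)` and then `P(r ^ 2)` by their upper bounds.
  have e1 : 2 * P' / (1 + r) ≤ (1 - r) * L / 2 := by
    rw [div_le_iff₀ h1r]
    linarith
  have e2 : 2 * P - r * (2 * P / (1 + r)) ≤ r * F / 2 := by
    have : 2 * P - r * (2 * P / (1 + r)) = 2 * P / (1 + r) := by field_simp; ring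
    rw [this, div_le_iff₀ h1r]
    nlinarith [mul_pos h0 hF]
  have e3 : 2 * P' / (1 + r) * (r * (1 - r) * F + 4 * P)
      ≤ (1 - r) * L / 2 * (r * (1 - r) * F + 4 * P) :=
    mul_le_mul_of_nonneg_right e1 (by positivity)
  have e4 : (1 - r) * L * (2 * P - r * (2 * P / (1 + r))) ≤ (1 - r) * L * (r * F / 2) :=
    mul_le_mul_of_nonneg_left e2 (by positivity)
  have e5 : 0 < (1 - r) * L * (r ^ 2 * F) := by positivity
  linarith

/-- The logarithm of `K g'` is `D ∘ g - D`, whose derivative is a positive multiple of the increment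
of `D' / ν'` between `t` and `g(t) > t`. -/
theorem strictMono_deriv_linearizedPhi {K : ℝ} (hK : 1 < K) :
    StrictMono (deriv (linearizedPhi K)) := by
  have hK0 : 0 < K := by linarith
  have hd : StrictMono fun t => logDensity (linearizedPhi K t) - logDensity t := by
    refine strictMono_of_deriv_pos fun t => ?_
    have h := ((hasDerivAt_logDensity (linearizedPhi K t)).comp t
      (hasDerivAt_linearizedPhi hK0 t)).sub (hasDerivAt_logDensity t)
    have h' : HasDerivAt (fun t => logDensity (linearizedPhi K t) - logDensity t) _ t := h
    have p1 := hypQ_pos (linearizedPhi K t)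
    have p2 := hypQCompl_pos (linearizedPhi K t)
    have p3 := (linQ_mem (linearizedPhi K t)).1
    have q1 := hypQ_pos t
    have q2 := hypQCompl_pos t
    have q3 := (linQ_mem t).1
    rw [h'.deriv, div_mul_div_cancel₀ (by positivity), ← sub_div]
    exact div_pos (sub_pos.mpr (strictMono_densitySlope (lt_linearizedPhi hK t))) (by positivity)
  intro s t hst
  rw [deriv_linearizedPhi hK0, deriv_linearizedPhi hK0]
  have := hd hst
  gcongr

theorem continuous_deriv_linearizedPhi {K : ℝ} (hK : 0 < K) :
    Continuous (deriv (linearizedPhi K)) := by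
  have hD : Continuous logDensity :=
    continuous_iff_continuousAt.mpr fun t => (hasDerivAt_logDensity t).continuousAt
  have hg : Continuous (linearizedPhi K) :=
    continuous_iff_continuousAt.mpr fun t => (hasDerivAt_linearizedPhi hK t).continuousAt
  rw [show deriv (linearizedPhi K) = fun t => _ from funext (deriv_linearizedPhi hK)]
  fun_prop

theorem tendsto_deriv_linearizedPhi_atBot {K : ℝ} (hK : 0 < K) :
    Tendsto (deriv (linearizedPhi K)) atBot (𝓝 (1 / K)) := by
  have hD : Tendsto logDensity atBot (𝓝 0) := by
    have h1 := ((tendsto_nhdsWithin_iff.mp tendsto_linQ_atBot).1.const_add 1).log (by norm_num)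
    have h2 := (tendsto_hypQ_atBot.log one_ne_zero).const_mul 2
    have h := h1.add h2
    simp only [add_zero, Real.log_one, mul_zero] at h
    exact h
  rw [show deriv (linearizedPhi K) = fun t => _ from funext (deriv_linearizedPhi hK)]
  have h := (((hD.comp (tendsto_linearizedPhi_atBot hK)).sub hD).rexp).const_mul (1 / K)
  simpa using h

theorem tendsto_deriv_linearizedPhi_atTop {K : ℝ} (hK : 0 < K) :
    Tendsto (deriv (linearizedPhi K)) atTop (𝓝 K) := by
  have hD : Tendsto (fun t => (1 + linQ t) * hypQCompl t ^ 2) atTop (𝓝 ((1 + 1) * 1 ^ 2)) :=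
    ((tendsto_nhdsWithin_iff.mp tendsto_linQ_atTop).1.const_add 1).mul
      (tendsto_hypQCompl_atTop.pow 2)
  rw [show deriv (linearizedPhi K) = fun t => _ from funext (deriv_linearizedPhi' hK)]
  have h := ((hD.comp (tendsto_linearizedPhi_atTop hK)).div hD (by norm_num)).const_mul K
  rw [div_self (by norm_num), mul_one] at h
  exact h

theorem StrictMono.range_eq_Ioo_of_tendsto {f : ℝ → ℝ} {a b : ℝ} (hf : StrictMono f)
    (hc : Continuous f) (ha : Tendsto f atBot (𝓝 a)) (hb : Tendsto f atTop (𝓝 b)) :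
    range f = Ioo a b := by
  refine Subset.antisymm ?_ fun y hy => ?_
  · rintro _ ⟨x, rfl⟩
    exact ⟨(hf.monotone.le_of_tendsto ha (x - 1)).trans_lt (hf (by linarith)),
      (hf (by linarith : x < x + 1)).trans_le (hf.monotone.ge_of_tendsto hb (x + 1))⟩
  · obtain ⟨s, hs⟩ := (ha.eventually (gt_mem_nhds hy.1)).exists
    obtain ⟨t, ht⟩ := (hb.eventually (lt_mem_nhds hy.2)).exists
    exact mem_range_of_exists_le_of_exists_ge hc ⟨s, hs.le⟩ ⟨t, ht.le⟩

end

theorem theorem3p53 (K : ℝ) (hK : 1 < K) :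
    Differentiable ℝ (linearizedPhi K) ∧
      StrictMono (deriv (linearizedPhi K)) ∧
      Set.range (deriv (linearizedPhi K)) = Set.Ioo (1 / K) K := by
  have hK0 : 0 < K := by linarith
  exact ⟨fun t => (hasDerivAt_linearizedPhi hK0 t).differentiableAt,
    strictMono_deriv_linearizedPhi hK,
    (strictMono_deriv_linearizedPhi hK).range_eq_Ioo_of_tendsto
      (continuous_deriv_linearizedPhi hK0) (tendsto_deriv_linearizedPhi_atBot hK0)
      (tendsto_deriv_linearizedPhi_atTop hK0)⟩
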